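/- **Theorem 8.2 (chain rule for coderivatives).** All spaces are real. For a set-valued mapping $F\colon X\rightrightarrows Y$ put $\operatorname{dom}F=\{x\in X: F(x)\neq\emptyset\}$, $\operatorname{rge}F=\bigcup_{x\in X}F(x)$, $\operatorname{gph}F=\{(x,y)\in X\times Y: y\in F(x)\}$, and $F^{-1}(y)=\{x\in X: y\in F(x)\}$. The composition of $F\colon X\rightrightarrows Y$ and $G\colon Y\rightrightarrows Z$ is $(G\circ F)(x)=\bigcup_{y\in F(x)}G(y)$. For a convex set $\Omega\subset X$ and $\bar x\in\Omega$, the normal cone is $N(\bar x;\Omega)=\{x^*\in X^*: \langle x^*,x-\bar x\rangle\le 0\text{ for all }x\in\Omega\}$, where $X^*$ is the topological dual of $X$. For $F$ with convex graph and $(\bar x,\bar y)\in\operatorname{gph}F$, the coderivative $D^*F(\bar x,\bar y)\colon Y^*\rightrightarrows X^*$ is given by $D^*F(\bar x,\bar y)(y^*)=\{x^*\in X^*: (x^*,-y^*)\in N((\bar x,\bar y);\operatorname{gph}F)\}$. Let $X,Y,Z$ be separated (Hausdorff) locally convex topological vector spaces, and let $F\colon X\rightrightarrows Y$ and $G\colon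 Y\rightrightarrows Z$ be set-valued mappings with convex graphs. Suppose that one of the following groups of assumptions is satisfied: (i) Either $\operatorname{int}(\operatorname{gph}F)\neq\emptyset$ and $\operatorname{int}(\operatorname{rge}F)\cap\operatorname{dom}G\neq\emptyset$, or $\operatorname{int}(\operatorname{gph}F)\neq\emptyset$ and $\operatorname{rge}F\cap\operatorname{int}(\operatorname{dom}G)\neq\emptyset$. (ii) The spaces $X,Y,Z$ are Banach, the graphs of $F$ and $G$ are closed, and the set $\{t(u-v): t>0,\ u\in\operatorname{rge}F,\ v\in\operatorname{dom}G\}$ is a closed linear subspace of $Y$. Then for all $(\bar x,\bar z)\in\operatorname{gph}(G\circ F)$ and all $z^*\in Z^*$, $$D^*(G\circ F)(\bar x,\bar z)(z^*)=\big(D^*F(\bar x,\bar y)\circ D^*G(\bar y,\bar z)\big)(z^*)\quad\text{for every }\bar y\in F(\bar x)\cap G^{-1}(\bar z).$$ -/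

import Mathlib

open scoped Pointwise

namespace SetValued

section Basic

/-- The domain `{x | F x ≠ ∅}` of a set-valued mapping `F : X ⇉ Y`. -/
def dom {X Y : Type*} (F : X → Set Y) : Set X := {x | (F x).Nonempty}

/-- The range `⋃ x, F x` of a set-valued mapping. -/
def rge {X Y : Type*} (F : X → Set Y) : Set Y := ⋃ x, F x

/-- The graph `{(x, y) | y ∈ F x}` of a set-valued mapping. -/
def gph {X Y : Type*} (F : X → Set Y) : Set (X × Y) := {p | p.2 ∈ F p.1}

/-- The inverse set-valued mapping, `x ∈ F⁻¹ y ↔ y ∈ F x`. -/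
def inv {X Y : Type*} (F : X → Set Y) : Y → Set X := fun y => {x | y ∈ F x}

/-- The composition `(G ∘ F) x = ⋃ y ∈ F x, G y` of set-valued mappings. -/
def comp {X Y Z : Type*} (G : Y → Set Z) (F : X → Set Y) : X → Set Z :=
  fun x => ⋃ y ∈ F x, G y

end Basic

section Dual

/-- The set `{t • v | t > 0, v ∈ Ω}` of positive multiples of elements of `Ω`. -/
def posMultiples {X : Type*} [AddCommGroup X] [Module ℝ X] (Ω : Set X) : Set X :=
  {x | ∃ t : ℝ, 0 < t ∧ ∃ v ∈ Ω, x = t • v}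

/-- `S` is (the carrier of) a closed linear subspace. -/
def IsClosedSubspace {X : Type*} [AddCommGroup X] [Module ℝ X] [TopologicalSpace X]
    (S : Set X) : Prop :=
  IsClosed S ∧ ∃ L : Submodule ℝ X, (L : Set X) = S

/-- The normal cone of convex analysis to `Ω` at `a` (meant for `a ∈ Ω`), a subset of the
topological dual. -/
def normalCone {X : Type*} [AddCommGroup X] [Module ℝ X] [TopologicalSpace X]
    (a : X) (Ω : Set X) : Set (X →L[ℝ] ℝ) :=
  {φ | ∀ x ∈ Ω, φ (x - a) ≤ 0}

/-- The coderivative `D*F(a, b) : Y* ⇉ X*` (meant for `(a, b)` in the graph of `F`):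
`x* ∈ D*F(a, b)(y*)` iff `(x*, -y*)` is normal to the graph of `F` at `(a, b)`.  The pair
`(x*, -y*)` is the functional `(x, y) ↦ x* x - y* y` on `X × Y`. -/
def coderivative {X Y : Type*}
    [AddCommGroup X] [Module ℝ X] [TopologicalSpace X]
    [AddCommGroup Y] [Module ℝ Y] [TopologicalSpace Y]
    (F : X → Set Y) (a : X) (b : Y) : (Y →L[ℝ] ℝ) → Set (X →L[ℝ] ℝ) :=
  fun ys => {xs | ContinuousLinearMap.coprod xs (-ys) ∈ normalCone (a, b) (gph F)}

end Dual

end SetValued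

/-! Membership of `xs` in the coderivative of the composition says that `zs (z' - z) - xs (x' - x)`
is nonnegative whenever `u ∈ F x'`, `z' ∈ G v` and `u = v`. Relax `u = v` and take the infimum over
each mismatch `w = u - v`: this value is convex in `w` and nonnegative at `w = 0`. A continuous
linear minorant `φ` of it is a Lagrange multiplier, and `-φ` is the intermediate functional
(`coderivative_comp_eq`). The other inclusion just chains two inequalities and needs no
qualification.

`exists_linear_minorant` obtains `φ` by separation, provided the epigraph has interior and the
mismatches fill a neighbourhood of the origin. Under (i) the interior comes from that of `gph F`.
Under (ii) both come from the Robinson–Ursescu theorem inside the closed subspace of mismatches, and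
Hahn–Banach extends `φ` to `Y`. -/

namespace SetValued

open Filter Topology Set

/-! ### Separation: nonvertical support of a convex epigraph. -/

section Support

variable {E : Type*} [AddCommGroup E] [Module ℝ E] [TopologicalSpace E] [IsTopologicalAddGroup E]
  [ContinuousSMul ℝ E]

/-- A continuous linear functional that is nonnegative near the origin vanishes. -/
theorem continuousLinearMap_eq_zero_of_eventually_nonneg (φ : E →L[ℝ] ℝ)
    (h : ∀ᶠ w in 𝓝 (0 : E), 0 ≤ φ w) : φ = 0 := by
  have key : ∀ w, 0 ≤ φ w := by
    intro w
    have ht : Tendsto (fun t : ℝ => t • w) (𝓝[>] 0) (𝓝 0) := by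
      have : Tendsto (fun t : ℝ => t • w) (𝓝 0) (𝓝 ((0 : ℝ) • w)) :=
        Continuous.tendsto (by fun_prop) 0
      rw [zero_smul] at this
      exact this.mono_left nhdsWithin_le_nhds
    obtain ⟨t, h1, h2⟩ := ((ht.eventually h).and self_mem_nhdsWithin).exists
    rw [map_smul, smul_eq_mul] at h1
    exact nonneg_of_mul_nonneg_right h1 h2
  ext w
  have h1 := key w
  have h2 := key (-w)
  rw [map_neg] at h2
  simp only [zero_apply]
  linarith

/-- A convex epigraph with nonempty interior, whose domain is a neighbourhood of the origin and
which lies above `0` over the origin, lies above the graph of a continuous linear functional. -/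
theorem exists_linear_minorant {P : Set (E × ℝ)} (hP : Convex ℝ P)
    (hup : ∀ w α β, (w, α) ∈ P → α ≤ β → (w, β) ∈ P)
    (hint : (interior P).Nonempty)
    (hdom : ∀ᶠ w in 𝓝 (0 : E), ∃ α, (w, α) ∈ P)
    (h0 : ∀ α, ((0 : E), α) ∈ P → 0 ≤ α) :
    ∃ φ : E →L[ℝ] ℝ, ∀ w α, (w, α) ∈ P → φ w ≤ α := by
  have hnot : ((0 : E), (0 : ℝ)) ∉ interior P := by
    intro hmem
    have ht : Tendsto (fun t : ℝ => ((0 : E), t)) (𝓝[<] 0) (𝓝 ((0 : E), (0 : ℝ))) :=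
      (Continuous.tendsto (f := fun t : ℝ => ((0 : E), t)) (by fun_prop) 0).mono_left
        nhdsWithin_le_nhds
    obtain ⟨t, h1, h2⟩ :=
      ((ht.eventually (mem_interior_iff_mem_nhds.1 hmem)).and self_mem_nhdsWithin).exists
    exact absurd (h0 t h1) (not_le.2 h2)
  obtain ⟨f, hf⟩ := geometric_hahn_banach_point_open hP.interior isOpen_interior hnot
  have hzero : f ((0 : E), (0 : ℝ)) = 0 := map_zero f
  rw [hzero] at hf
  have hnn : ∀ p ∈ P, 0 ≤ f p := by
    intro p hp
    have hcl : p ∈ closure (interior P) := by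
      rw [hP.closure_interior_eq_closure_of_nonempty_interior hint]
      exact subset_closure hp
    exact closure_minimal (t := {q | 0 ≤ f q}) (fun q hq => (hf q hq).le)
      (isClosed_le continuous_const f.continuous) hcl
  set φ : E →L[ℝ] ℝ := f.comp (ContinuousLinearMap.inl ℝ E ℝ) with hφ
  set c : ℝ := f (0, 1) with hc
  have hsplit : ∀ w α, f (w, α) = φ w + α * c := by
    intro w α
    have h1 : ((w, α) : E × ℝ) = (w, 0) + α • (0, 1) := by simp
    rw [h1, map_add, map_smul]
    simp [hφ, hc]
  obtain ⟨α₀, hα₀⟩ := hdom.self_of_nhds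
  have hc0 : 0 ≤ c := by
    have h1 := hnn _ (hup 0 α₀ (max α₀ 1) hα₀ (le_max_left _ _))
    rw [hsplit, map_zero, zero_add] at h1
    exact nonneg_of_mul_nonneg_right h1 (lt_of_lt_of_le one_pos (le_max_right _ _))
  -- The hyperplane is not vertical: with `c = 0`, `φ` would be nonnegative near the origin, hence
  -- zero, and `f` could not be positive on the interior.
  have hcpos : 0 < c := by
    refine lt_of_le_of_ne hc0 fun hcz => ?_
    have hφ0 : φ = 0 := by
      refine continuousLinearMap_eq_zero_of_eventually_nonneg φ (hdom.mono ?_)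
      rintro w ⟨α, hα⟩
      have := hnn _ hα
      rwa [hsplit, ← hcz, mul_zero, add_zero] at this
    obtain ⟨⟨w, α⟩, hp⟩ := hint
    have := hf _ hp
    rw [hsplit, ← hcz, hφ0] at this
    simp at this
  refine ⟨-(c⁻¹ • φ), fun w α hw => ?_⟩
  have := hnn _ hw
  rw [hsplit] at this
  have h2 : 0 ≤ c⁻¹ * (φ w + α * c) := mul_nonneg (inv_nonneg.2 hc0) this
  have h3 : c⁻¹ * (φ w + α * c) = c⁻¹ * φ w + α := by field_simp
  simp only [neg_apply, smul_apply, smul_eq_mul]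
  linarith

end Support

/-! ### The Robinson–Ursescu theorem. -/

section OpenMapping

variable {E W : Type*} [NormedAddCommGroup E] [NormedSpace ℝ E]
  [NormedAddCommGroup W] [NormedSpace ℝ W]

/-- A closed convex set whose positive multiples cover a Banach space, and which is star-shaped
at the origin, is a neighbourhood of the origin. -/
theorem mem_nhds_zero_of_isClosed_of_convex [CompleteSpace W] {K : Set W} (hK : Convex ℝ K)
    (hcl : IsClosed K) (h0 : (0 : W) ∈ K) (habs : ∀ w : W, ∃ t : ℝ, 0 < t ∧ ∃ k ∈ K, w = t • k) :
    K ∈ 𝓝 (0 : W) := by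
  have hscale : ∀ w : W, ∃ m : ℕ, ∀ n : ℕ, m ≤ n → ((n : ℝ) + 1)⁻¹ • w ∈ K := by
    intro w
    obtain ⟨t, ht, k, hk, rfl⟩ := habs w
    obtain ⟨m, hm⟩ := exists_nat_ge t
    refine ⟨m, fun n hn => ?_⟩
    have hn' : (m : ℝ) ≤ n := by exact_mod_cast hn
    rw [smul_smul]
    refine hK.smul_mem_of_zero_mem h0 hk ⟨by positivity, ?_⟩
    rw [inv_mul_le_one₀ (by positivity)]
    linarith
  -- Symmetrised for Baire: an interior point `a` then also gives `-(r • a) ∈ K`, and midpoints with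
  -- it move a neighbourhood of `r • a` to the origin.
  let S : ℕ → Set W := fun n =>
    {w | ((n : ℝ) + 1)⁻¹ • w ∈ K ∧ -(((n : ℝ) + 1)⁻¹ • w) ∈ K}
  have hS : ∀ n, IsClosed (S n) := fun n =>
    (hcl.preimage (by fun_prop : Continuous fun w : W => ((n : ℝ) + 1)⁻¹ • w)).inter
      (hcl.preimage (by fun_prop : Continuous fun w : W => -(((n : ℝ) + 1)⁻¹ • w)))
  have hU : ⋃ n, S n = univ := by
    refine eq_univ_of_forall fun w => mem_iUnion.2 ?_
    obtain ⟨m₁, h₁⟩ := hscale w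
    obtain ⟨m₂, h₂⟩ := hscale (-w)
    refine ⟨max m₁ m₂, h₁ _ (le_max_left _ _), ?_⟩
    rw [← smul_neg]
    exact h₂ _ (le_max_right _ _)
  obtain ⟨n, a, ha⟩ := nonempty_interior_of_iUnion_of_closed hS hU
  set r : ℝ := ((n : ℝ) + 1)⁻¹ with hr
  have hr0 : r ≠ 0 := by positivity
  have hmem : {w | r • w ∈ K} ∈ 𝓝 a :=
    mem_of_superset (mem_interior_iff_mem_nhds.1 ha) fun w hw => hw.1
  have hneg : -(r • a) ∈ K := (interior_subset ha).2
  have ht : Tendsto (fun w : W => (2 * r⁻¹) • w + a) (𝓝 0) (𝓝 a) := by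
    have : Tendsto (fun w : W => (2 * r⁻¹) • w + a) (𝓝 0) (𝓝 ((2 * r⁻¹) • 0 + a)) :=
      Continuous.tendsto (by fun_prop) 0
    simpa using this
  filter_upwards [ht hmem] with w hw
  have hw' : r • ((2 * r⁻¹) • w + a) ∈ K := hw
  have := hK hw' hneg (by norm_num : (0 : ℝ) ≤ 1 / 2) (by norm_num : (0 : ℝ) ≤ 1 / 2) (by norm_num)
  convert this using 1
  rw [smul_add, smul_smul, smul_add, smul_smul, smul_neg,
    show (1 / 2 : ℝ) * (r * (2 * r⁻¹)) = 1 by field_simp]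
  simp

/-- If the closure of the image of a bounded closed convex set is a neighbourhood of the origin,
then so is the image itself. -/
theorem image_mem_nhds_zero_of_closure [CompleteSpace E] {B : Set E} (hB : Convex ℝ B)
    (hcl : IsClosed B) (hbd : Bornology.IsBounded B) (T : E →L[ℝ] W)
    (h : closure (T '' B) ∈ 𝓝 (0 : W)) : T '' B ∈ 𝓝 (0 : W) := by
  obtain ⟨r, hr, hball⟩ := Metric.mem_nhds_iff.1 h
  have hstep : ∀ w : W, ‖w‖ < r → ∃ b ∈ B, ‖(2 : ℝ) • (w - T b)‖ < r := by
    intro w hw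
    obtain ⟨_, ⟨b, hb, rfl⟩, hd⟩ :=
      Metric.mem_closure_iff.1 (hball (mem_ball_zero_iff.2 hw)) (r / 2) (by positivity)
    refine ⟨b, hb, ?_⟩
    rw [dist_eq_norm] at hd
    rw [norm_smul, Real.norm_ofNat]
    linarith
  choose! b hbB hb using hstep
  obtain ⟨M, hM⟩ := hbd.exists_norm_le
  refine Metric.mem_nhds_iff.2 ⟨r / 2, by positivity, fun w hw => ?_⟩
  rw [mem_ball_zero_iff] at hw
  -- Successive remainders, doubled at each step so that they stay in the ball of radius `r`;
  -- starting at `2 • w` is why `w` ranges over radius `r / 2`.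
  let s : ℕ → W := fun n => Nat.rec ((2 : ℝ) • w) (fun _ v => (2 : ℝ) • (v - T (b v))) n
  have hs : ∀ n, ‖s n‖ < r := by
    intro n
    induction n with
    | zero =>
      change ‖(2 : ℝ) • w‖ < r
      rw [norm_smul, Real.norm_ofNat]
      linarith
    | succ n ih => exact hb _ ih
  let p : ℕ → E := fun n => ∑ k ∈ Finset.range n, ((1 / 2 : ℝ) ^ (k + 1)) • b (s k)
  have hTp : ∀ n, T (p n) = w - ((1 / 2 : ℝ) ^ (n + 1)) • s n := by
    intro n
    induction n with
    | zero =>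
      change T (∑ k ∈ Finset.range 0, _) = w - ((1 / 2 : ℝ) ^ (0 + 1)) • ((2 : ℝ) • w)
      rw [smul_smul]
      norm_num
    | succ n ih =>
      have h1 : p (n + 1) = p n + ((1 / 2 : ℝ) ^ (n + 1)) • b (s n) := Finset.sum_range_succ _ _
      have h2 : s (n + 1) = (2 : ℝ) • (s n - T (b (s n))) := rfl
      rw [h1, h2, map_add, ih, map_smul, smul_smul,
        show (1 / 2 : ℝ) ^ (n + 1 + 1) * 2 = (1 / 2 : ℝ) ^ (n + 1) by ring, smul_sub]
      abel
  -- The weights in `p n` sum to `1 - (1 / 2) ^ n`; a point of `B` with the missing weight completes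
  -- a convex combination.
  have hconv : ∀ n, ∀ c ∈ B, p n + ((1 / 2 : ℝ) ^ n) • c ∈ B := by
    intro n
    induction n with
    | zero => intro c hc; simpa [p] using hc
    | succ n ih =>
      intro c hc
      have h1 : p (n + 1) = p n + ((1 / 2 : ℝ) ^ (n + 1)) • b (s n) := Finset.sum_range_succ _ _
      have h2 := ih _ (hB (hbB _ (hs n)) hc (by norm_num : (0 : ℝ) ≤ 1 / 2)
        (by norm_num : (0 : ℝ) ≤ 1 / 2) (by norm_num))
      convert h2 using 1
      rw [h1, smul_add, smul_smul, smul_smul, ← pow_succ, add_assoc]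
  have hpow : Tendsto (fun n : ℕ => (1 / 2 : ℝ) ^ n) atTop (𝓝 0) :=
    tendsto_pow_atTop_nhds_zero_of_lt_one (by norm_num) (by norm_num)
  have hsum : Summable fun k => ((1 / 2 : ℝ) ^ (k + 1)) • b (s k) := by
    refine Summable.of_norm_bounded (g := fun k => (1 / 2 : ℝ) ^ k * M)
      (summable_geometric_two.mul_right M) fun k => ?_
    rw [norm_smul, Real.norm_of_nonneg (by positivity)]
    exact mul_le_mul (pow_le_pow_of_le_one (by norm_num) (by norm_num) (Nat.le_succ k))
      (hM _ (hbB _ (hs k))) (norm_nonneg _) (by positivity)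
  obtain ⟨q, hq⟩ := hsum
  have hpq : Tendsto p atTop (𝓝 q) := hq.tendsto_sum_nat
  refine ⟨q, ?_, ?_⟩
  · have h1 : Tendsto (fun n => p n + ((1 / 2 : ℝ) ^ n) • b (s 0)) atTop
        (𝓝 (q + (0 : ℝ) • b (s 0))) := hpq.add (hpow.smul_const _)
    rw [zero_smul, add_zero] at h1
    exact hcl.mem_of_tendsto h1 (Eventually.of_forall fun n => hconv n _ (hbB _ (hs 0)))
  · have h1 : Tendsto (fun n => T (p n)) atTop (𝓝 (T q)) := (T.continuous.tendsto q).comp hpq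
    have h2 : Tendsto (fun n => ((1 / 2 : ℝ) ^ (n + 1)) • s n) atTop (𝓝 0) := by
      refine squeeze_zero_norm (a := fun n => (1 / 2 : ℝ) ^ (n + 1) * r) (fun n => ?_) ?_
      · rw [norm_smul, Real.norm_of_nonneg (by positivity)]
        exact mul_le_mul_of_nonneg_left (hs n).le (by positivity)
      · simpa using (hpow.comp (tendsto_add_atTop_nat 1)).mul_const r
    have h3 : Tendsto (fun n => T (p n)) atTop (𝓝 w) := by
      simp_rw [hTp]
      simpa using tendsto_const_nhds.sub h2
    exact tendsto_nhds_unique h1 h3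

/-- Robinson–Ursescu: if the positive multiples of the linear image of a closed convex set `C`
cover a Banach space, then the image of the part of `C` near a preimage of the origin is a
neighbourhood of the origin. -/
theorem image_inter_closedBall_mem_nhds_zero [CompleteSpace E] [CompleteSpace W] {C : Set E}
    (hC : Convex ℝ C) (hcl : IsClosed C) (T : E →L[ℝ] W) {c₀ : E} (hc₀ : c₀ ∈ C) (hT : T c₀ = 0)
    (habs : ∀ w : W, ∃ t : ℝ, 0 < t ∧ ∃ c ∈ C, w = t • T c) :
    T '' (C ∩ Metric.closedBall c₀ 1) ∈ 𝓝 (0 : W) := by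
  have hconv : Convex ℝ (C ∩ Metric.closedBall c₀ 1) := hC.inter (convex_closedBall _ _)
  refine image_mem_nhds_zero_of_closure hconv (hcl.inter Metric.isClosed_closedBall)
    (Metric.isBounded_closedBall.subset inter_subset_right) T ?_
  refine mem_nhds_zero_of_isClosed_of_convex (hconv.linear_image T.toLinearMap).closure
    isClosed_closure (subset_closure ⟨c₀, ⟨hc₀, by simp⟩, hT⟩) fun w => ?_
  obtain ⟨t, ht, c, hc, rfl⟩ := habs w
  set N : ℝ := ‖c - c₀‖ + 1 with hN
  have hNpos : 0 < N := by positivity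
  refine ⟨t * N, by positivity, N⁻¹ • T c, subset_closure ⟨c₀ + N⁻¹ • (c - c₀), ⟨?_, ?_⟩, ?_⟩, ?_⟩
  · exact hC.add_smul_sub_mem hc₀ hc ⟨by positivity, inv_le_one_of_one_le₀ (by simp [hN])⟩
  · rw [mem_closedBall_iff_norm, add_sub_cancel_left, norm_smul,
      Real.norm_of_nonneg (by positivity), inv_mul_le_one₀ hNpos]
    linarith
  · rw [map_add, map_smul, map_sub, hT, zero_add, sub_zero]
  · rw [smul_smul, mul_assoc, mul_inv_cancel₀ hNpos.ne', mul_one]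

end OpenMapping

/-! ### Coderivatives and the mismatch value function. -/

section ChainRule

variable {X Y Z : Type*}
  [AddCommGroup X] [Module ℝ X] [TopologicalSpace X]
  [AddCommGroup Y] [Module ℝ Y] [TopologicalSpace Y]
  [AddCommGroup Z] [Module ℝ Z] [TopologicalSpace Z]

theorem mem_coderivative_iff {F : X → Set Y} {a : X} {b : Y} {ys : Y →L[ℝ] ℝ} {xs : X →L[ℝ] ℝ} :
    xs ∈ coderivative F a b ys ↔ ∀ x y, y ∈ F x → xs (x - a) ≤ ys (y - b) := by
  constructor
  · intro h x y hxy
    have := h (x, y) hxy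
    simp [ContinuousLinearMap.coprod_apply] at this
    simp only [map_sub]
    linarith
  · rintro h ⟨x, y⟩ hxy
    have := h x y hxy
    simp only [map_sub] at this
    simp [ContinuousLinearMap.coprod_apply]
    linarith

theorem mem_comp_iff {A B C : Type*} {F : A → Set B} {G : B → Set C} {a : A} {c : C} :
    c ∈ comp G F a ↔ ∃ b ∈ F a, c ∈ G b := by
  simp [comp]

/-- The epigraph of the optimal value, as a function of the mismatch `u - v`, of the problem
whose dual solutions are the intermediate functionals in the chain rule. -/
def mismatchEpigraph (F : X → Set Y) (G : Y → Set Z) (x : X) (z : Z) (xs : X →L[ℝ] ℝ)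
    (zs : Z →L[ℝ] ℝ) : Set (Y × ℝ) :=
  {p | ∃ x' u v z', u ∈ F x' ∧ z' ∈ G v ∧ p.1 = u - v ∧ zs (z' - z) - xs (x' - x) ≤ p.2}

theorem convex_mismatchEpigraph {F : X → Set Y} {G : Y → Set Z} (hF : Convex ℝ (gph F))
    (hG : Convex ℝ (gph G)) (x : X) (z : Z) (xs : X →L[ℝ] ℝ) (zs : Z →L[ℝ] ℝ) :
    Convex ℝ (mismatchEpigraph F G x z xs zs) := by
  rintro ⟨_, α⟩ ⟨x₁, u₁, v₁, z₁, hF₁, hG₁, rfl, h₁⟩ ⟨_, β⟩ ⟨x₂, u₂, v₂, z₂, hF₂, hG₂, rfl, h₂⟩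
    s t hs ht hst
  refine ⟨s • x₁ + t • x₂, s • u₁ + t • u₂, s • v₁ + t • v₂, s • z₁ + t • z₂,
    hF (x := (x₁, u₁)) hF₁ (y := (x₂, u₂)) hF₂ hs ht hst,
    hG (x := (v₁, z₁)) hG₁ (y := (v₂, z₂)) hG₂ hs ht hst, ?_, ?_⟩
  · simp only [Prod.fst_add, Prod.smul_fst, smul_sub]
    abel
  · simp only [map_sub] at h₁ h₂
    simp only [map_sub, map_add, map_smul, smul_eq_mul, Prod.snd_add, Prod.smul_snd]
    have e₁ := mul_le_mul_of_nonneg_left h₁ hs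
    have e₂ := mul_le_mul_of_nonneg_left h₂ ht
    have e₃ : zs z = s * zs z + t * zs z := by rw [← add_mul, hst, one_mul]
    have e₄ : xs x = s * xs x + t * xs x := by rw [← add_mul, hst, one_mul]
    linarith

theorem mismatchEpigraph_upward {F : X → Set Y} {G : Y → Set Z} {x : X} {z : Z} {xs : X →L[ℝ] ℝ}
    {zs : Z →L[ℝ] ℝ} {w : Y} {α β : ℝ} (h : (w, α) ∈ mismatchEpigraph F G x z xs zs)
    (hαβ : α ≤ β) : (w, β) ∈ mismatchEpigraph F G x z xs zs := by
  obtain ⟨x', u, v, z', hu, hz, hw, hα⟩ := h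
  exact ⟨x', u, v, z', hu, hz, hw, hα.trans hαβ⟩

theorem nonneg_of_mem_mismatchEpigraph {F : X → Set Y} {G : Y → Set Z} {x : X} {z : Z}
    {xs : X →L[ℝ] ℝ} {zs : Z →L[ℝ] ℝ} (hxs : xs ∈ coderivative (comp G F) x z zs) {α : ℝ}
    (h : (0, α) ∈ mismatchEpigraph F G x z xs zs) : 0 ≤ α := by
  obtain ⟨x', u, v, z', hu, hz, hw, hα⟩ := h
  obtain rfl : u = v := sub_eq_zero.1 hw.symm
  have := mem_coderivative_iff.1 hxs x' z' (mem_comp_iff.2 ⟨u, hu, hz⟩)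
  dsimp only at hα
  linarith

/-- The chain rule, given linear minorants of the value functions. -/
theorem coderivative_comp_eq {F : X → Set Y} {G : Y → Set Z} {x : X} {y : Y} {z : Z}
    {zs : Z →L[ℝ] ℝ} (hy : y ∈ F x ∩ inv G z)
    (h : ∀ xs ∈ coderivative (comp G F) x z zs, ∃ φ : Y →L[ℝ] ℝ,
      ∀ w α, (w, α) ∈ mismatchEpigraph F G x z xs zs → φ w ≤ α)
    [IsTopologicalAddGroup Y] :
    coderivative (comp G F) x z zs = comp (coderivative F x y) (coderivative G y z) zs := by
  obtain ⟨hyF, hyG⟩ := hy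
  ext xs
  rw [mem_comp_iff]
  constructor
  · intro hxs
    obtain ⟨φ, hφ⟩ := h xs hxs
    -- Each half freezes the other mapping at its base point: `(x, y)` for `F`, then `(y, z)` for
    -- `G`.
    refine ⟨-φ, mem_coderivative_iff.2 fun v z' hz' => ?_, mem_coderivative_iff.2 fun x' u hu => ?_⟩
    · have := hφ (y - v) _ ⟨x, y, v, z', hyF, hz', rfl, le_rfl⟩
      simp only [map_sub, neg_apply] at this ⊢
      linarith
    · have := hφ (u - y) _ ⟨x', u, y, z, hu, hyG, rfl, le_rfl⟩
      simp only [map_sub, neg_apply] at this ⊢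
      linarith
  · rintro ⟨ys, hG, hF⟩
    rw [mem_coderivative_iff] at hG hF ⊢
    intro x' z' h'
    obtain ⟨u, hu, hz'⟩ := mem_comp_iff.1 h'
    exact (hF x' u hu).trans (hG u z' hz')

end ChainRule

/-! ### Multipliers under each qualification condition. -/

theorem exists_linear_minorant_of_interior {X Y Z : Type*}
    [AddCommGroup X] [Module ℝ X] [TopologicalSpace X]
    [AddCommGroup Y] [Module ℝ Y] [TopologicalSpace Y] [IsTopologicalAddGroup Y]
    [ContinuousSMul ℝ Y]
    [AddCommGroup Z] [Module ℝ Z] [TopologicalSpace Z]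
    {F : X → Set Y} {G : Y → Set Z} (hF : Convex ℝ (gph F)) (hG : Convex ℝ (gph G))
    (hint : (interior (gph F)).Nonempty) (hdom : rge F - dom G ∈ 𝓝 (0 : Y))
    {x : X} {z : Z} {xs : X →L[ℝ] ℝ} {zs : Z →L[ℝ] ℝ}
    (hxs : xs ∈ coderivative (comp G F) x z zs) :
    ∃ φ : Y →L[ℝ] ℝ, ∀ w α, (w, α) ∈ mismatchEpigraph F G x z xs zs → φ w ≤ α := by
  refine exists_linear_minorant (convex_mismatchEpigraph hF hG x z xs zs)
    (fun w α β => mismatchEpigraph_upward) ?_ ?_ fun α => nonneg_of_mem_mismatchEpigraph hxs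
  · obtain ⟨_, _, v, ⟨z', hz'⟩, _⟩ := mem_of_mem_nhds hdom
    obtain ⟨⟨x₀, u₀⟩, h₀⟩ := hint
    set m : ℝ := zs (z' - z) - xs (x₀ - x)
    -- With `x₀`, `v` and `z'` fixed, only `u` varies, so the cost stays equal to `m`.
    refine ⟨(u₀ - v, m + 1), interior_maximal (s := mismatchEpigraph F G x z xs zs)
      (t := {p : Y × ℝ | (x₀, p.1 + v) ∈ interior (gph F)} ∩ {p | m < p.2}) ?_ ?_ ?_⟩
    · rintro ⟨w, α⟩ ⟨h1, h2⟩
      exact ⟨x₀, w + v, v, z', interior_subset (s := gph F) h1, hz', by simp, le_of_lt h2⟩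
    · exact (isOpen_interior.preimage
        (by fun_prop : Continuous fun p : Y × ℝ => (x₀, p.1 + v))).inter
        (isOpen_lt continuous_const continuous_snd)
    · exact ⟨by simpa using h₀, by simp⟩
  · filter_upwards [hdom] with w hw
    obtain ⟨u, hu, v, ⟨z', hz'⟩, rfl⟩ := hw
    obtain ⟨x', hx'⟩ := mem_iUnion.1 hu
    exact ⟨_, x', u, v, z', hx', hz', rfl, le_rfl⟩

/-- Near the base point the cost is at most `‖zs‖ + ‖xs‖`, and by Robinson–Ursescu such points
already realise every small mismatch in `L`. The value function is thus bounded above near the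
origin of `L`. -/
theorem exists_linear_minorant_of_isClosedSubspace {X Y Z : Type*}
    [NormedAddCommGroup X] [NormedSpace ℝ X] [CompleteSpace X]
    [NormedAddCommGroup Y] [NormedSpace ℝ Y] [CompleteSpace Y]
    [NormedAddCommGroup Z] [NormedSpace ℝ Z] [CompleteSpace Z]
    {F : X → Set Y} {G : Y → Set Z} (hF : Convex ℝ (gph F)) (hG : Convex ℝ (gph G))
    (hFc : IsClosed (gph F)) (hGc : IsClosed (gph G))
    (hsub : IsClosedSubspace (posMultiples (rge F - dom G)))
    {x : X} {y : Y} {z : Z} (hy : y ∈ F x ∩ inv G z) {xs : X →L[ℝ] ℝ} {zs : Z →L[ℝ] ℝ}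
    (hxs : xs ∈ coderivative (comp G F) x z zs) :
    ∃ φ : Y →L[ℝ] ℝ, ∀ w α, (w, α) ∈ mismatchEpigraph F G x z xs zs → φ w ≤ α := by
  obtain ⟨hclosed, L, hL⟩ := hsub
  rw [← hL] at hclosed
  have : CompleteSpace L := hclosed.completeSpace_coe
  have hmemL : ∀ {x' u v z'}, u ∈ F x' → z' ∈ G v → u - v ∈ L := by
    intro x' u v z' hu hz'
    have h1 : u - v ∈ posMultiples (rge F - dom G) :=
      ⟨1, one_pos, _, sub_mem_sub (mem_iUnion.2 ⟨x', hu⟩) ⟨z', hz'⟩, (one_smul _ _).symm⟩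
    rwa [← hL] at h1
  let D : ((X × Y) × (Y × Z)) →L[ℝ] Y :=
    (ContinuousLinearMap.snd ℝ X Y).comp (ContinuousLinearMap.fst ℝ (X × Y) (Y × Z)) -
      (ContinuousLinearMap.fst ℝ Y Z).comp (ContinuousLinearMap.snd ℝ (X × Y) (Y × Z))
  have hD : ∀ e, D e = e.1.2 - e.2.1 := fun e => rfl
  -- Restricting to `E` lets the mismatch map land in `L`, where positive multiples cover
  -- everything; closedness of `L` keeps both spaces complete.
  let E : Submodule ℝ ((X × Y) × (Y × Z)) := L.comap D.toLinearMap
  have hE : IsClosed (E : Set ((X × Y) × (Y × Z))) := hclosed.preimage D.continuous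
  have : CompleteSpace E := hE.completeSpace_coe
  let T : E →L[ℝ] L := (D.comp E.subtypeL).codRestrict L fun e => e.2
  have hT : ∀ e : E, (T e : Y) = e.1.1.2 - e.1.2.1 := fun e => rfl
  let C : Set E := {e | e.1.1 ∈ gph F ∧ e.1.2 ∈ gph G}
  have hCconv : Convex ℝ C := (hF.prod hG).linear_preimage E.subtype
  have hCcl : IsClosed C := (hFc.prod hGc).preimage E.subtypeL.continuous
  let c₀ : E := ⟨((x, y), (y, z)), hmemL hy.1 hy.2⟩
  have hT₀ : T c₀ = 0 := Subtype.ext (by rw [hT]; exact sub_self y)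
  have himage := image_inter_closedBall_mem_nhds_zero hCconv hCcl T (c₀ := c₀) ⟨hy.1, hy.2⟩ hT₀ (by
    intro w
    have hw : (w : Y) ∈ posMultiples (rge F - dom G) := by rw [← hL]; exact w.2
    obtain ⟨t, ht, _, ⟨u, hu, v, ⟨z', hz'⟩, rfl⟩, hw⟩ := hw
    obtain ⟨x', hx'⟩ := mem_iUnion.1 hu
    exact ⟨t, ht, ⟨((x', u), (v, z')), hmemL hx' hz'⟩, ⟨hx', hz'⟩, Subtype.ext hw⟩)
  have hmem : ∀ e ∈ C, ∀ α, zs (e.1.2.2 - z) - xs (e.1.1.1 - x) ≤ α →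
      ((T e : Y), α) ∈ mismatchEpigraph F G x z xs zs := fun e he α hα =>
    ⟨e.1.1.1, e.1.1.2, e.1.2.1, e.1.2.2, he.1, he.2, rfl, hα⟩
  obtain ⟨φ, hφ⟩ : ∃ φ : L →L[ℝ] ℝ, ∀ w α,
      (w, α) ∈ {p : L × ℝ | ((p.1 : Y), p.2) ∈ mismatchEpigraph F G x z xs zs} → φ w ≤ α := by
    refine exists_linear_minorant
      ((convex_mismatchEpigraph hF hG x z xs zs).linear_preimage
        (L.subtype.prodMap (LinearMap.id : ℝ →ₗ[ℝ] ℝ)))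
      (fun w α β h hαβ => mismatchEpigraph_upward h hαβ) ?_ ?_
      fun α h => nonneg_of_mem_mismatchEpigraph hxs h
    · refine ⟨((0 : L), ‖zs‖ + ‖xs‖ + 1), mem_interior_iff_mem_nhds.2 ?_⟩
      filter_upwards [prod_mem_nhds himage (Ioi_mem_nhds (lt_add_one (‖zs‖ + ‖xs‖)))]
      rintro ⟨_, α⟩ ⟨⟨e, ⟨heC, heB⟩, rfl⟩, hα⟩
      refine hmem e heC α (le_trans ?_ (le_of_lt hα))
      have hnorm : ‖(e : (X × Y) × (Y × Z)) - c₀‖ ≤ 1 := mem_closedBall_iff_norm.1 heB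
      have hz : ‖e.1.2.2 - z‖ ≤ 1 := ((norm_snd_le _).trans (norm_snd_le _)).trans hnorm
      have hx : ‖e.1.1.1 - x‖ ≤ 1 := ((norm_fst_le _).trans (norm_fst_le _)).trans hnorm
      have h1 := (le_abs_self _).trans (zs.le_of_opNorm_le_of_le le_rfl hz)
      have h2 := (neg_le_abs _).trans (xs.le_of_opNorm_le_of_le le_rfl hx)
      linarith
    · filter_upwards [himage]
      rintro _ ⟨e, ⟨heC, -⟩, rfl⟩
      exact ⟨_, hmem e heC _ le_rfl⟩
  obtain ⟨ψ, hψ, -⟩ := exists_extension_norm_eq L φ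
  refine ⟨ψ, fun w α hw => ?_⟩
  have hwL : w ∈ L := by
    obtain ⟨x', u, v, z', hu, hz', h1, -⟩ := hw
    dsimp only at h1
    rw [h1]
    exact hmemL hu hz'
  rw [show ψ w = φ ⟨w, hwL⟩ from hψ ⟨w, hwL⟩]
  exact hφ ⟨w, hwL⟩ α hw

/-- Positivity of interiors in the sense of the chain rule makes `rge F - dom G` a neighbourhood
of the origin. -/
theorem sub_mem_nhds_zero_of_interior_inter {Y : Type*} [AddCommGroup Y] [TopologicalSpace Y]
    [IsTopologicalAddGroup Y] {A B : Set Y}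
    (h : (interior A ∩ B).Nonempty ∨ (A ∩ interior B).Nonempty) : A - B ∈ 𝓝 (0 : Y) := by
  rcases h with ⟨p, hA, hB⟩ | ⟨p, hA, hB⟩
  · have ht : Tendsto (fun w : Y => w + p) (𝓝 0) (𝓝 p) := by
      simpa using (Continuous.tendsto (by fun_prop : Continuous fun w : Y => w + p) 0)
    filter_upwards [ht (mem_interior_iff_mem_nhds.1 hA)] with w hw
    exact ⟨w + p, hw, p, hB, add_sub_cancel_right w p⟩
  · have ht : Tendsto (fun w : Y => p - w) (𝓝 0) (𝓝 p) := by
      simpa using (Continuous.tendsto (by fun_prop : Continuous fun w : Y => p - w) 0)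
    filter_upwards [ht (mem_interior_iff_mem_nhds.1 hB)] with w hw
    exact ⟨p, hA, p - w, hw, sub_sub_cancel p w⟩

end SetValued

theorem theorem8p2 :
    -- (i) separated locally convex spaces, interiority conditions
    (∀ (X Y Z : Type*)
      [AddCommGroup X] [Module ℝ X] [TopologicalSpace X] [IsTopologicalAddGroup X]
      [ContinuousSMul ℝ X] [LocallyConvexSpace ℝ X] [T2Space X]
      [AddCommGroup Y] [Module ℝ Y] [TopologicalSpace Y] [IsTopologicalAddGroup Y]
      [ContinuousSMul ℝ Y] [LocallyConvexSpace ℝ Y] [T2Space Y]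
      [AddCommGroup Z] [Module ℝ Z] [TopologicalSpace Z] [IsTopologicalAddGroup Z]
      [ContinuousSMul ℝ Z] [LocallyConvexSpace ℝ Z] [T2Space Z]
      (F : X → Set Y) (G : Y → Set Z),
      Convex ℝ (SetValued.gph F) → Convex ℝ (SetValued.gph G) →
      (((interior (SetValued.gph F)).Nonempty ∧
          (interior (SetValued.rge F) ∩ SetValued.dom G).Nonempty) ∨
        ((interior (SetValued.gph F)).Nonempty ∧
          (SetValued.rge F ∩ interior (SetValued.dom G)).Nonempty)) →
      ∀ (x : X) (z : Z), (x, z) ∈ SetValued.gph (SetValued.comp G F) →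
      ∀ (zs : Z →L[ℝ] ℝ) (y : Y), y ∈ F x ∩ SetValued.inv G z →
        SetValued.coderivative (SetValued.comp G F) x z zs =
          SetValued.comp (SetValued.coderivative F x y) (SetValued.coderivative G y z) zs) ∧
    -- (ii) Banach spaces, closed graphs, the Attouch-Brezis condition
    (∀ (X Y Z : Type*)
      [NormedAddCommGroup X] [NormedSpace ℝ X] [CompleteSpace X]
      [NormedAddCommGroup Y] [NormedSpace ℝ Y] [CompleteSpace Y]
      [NormedAddCommGroup Z] [NormedSpace ℝ Z] [CompleteSpace Z]
      (F : X → Set Y) (G : Y → Set Z),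
      Convex ℝ (SetValued.gph F) → Convex ℝ (SetValued.gph G) →
      IsClosed (SetValued.gph F) → IsClosed (SetValued.gph G) →
      SetValued.IsClosedSubspace
        (SetValued.posMultiples (SetValued.rge F - SetValued.dom G)) →
      ∀ (x : X) (z : Z), (x, z) ∈ SetValued.gph (SetValued.comp G F) →
      ∀ (zs : Z →L[ℝ] ℝ) (y : Y), y ∈ F x ∩ SetValued.inv G z →
        SetValued.coderivative (SetValued.comp G F) x z zs =
          SetValued.comp (SetValued.coderivative F x y) (SetValued.coderivative G y z) zs) := by
  constructor
  · intro X Y Z _ _ _ _ _ _ _ _ _ _ _ _ _ _ _ _ _ _ _ _ _ F G hF hG h x z _ zs y hy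
    rw [← and_or_left] at h
    exact SetValued.coderivative_comp_eq hy fun xs hxs =>
      SetValued.exists_linear_minorant_of_interior hF hG h.1
        (SetValued.sub_mem_nhds_zero_of_interior_inter h.2) hxs
  · intro X Y Z _ _ _ _ _ _ _ _ _ F G hF hG hFc hGc hsub x z _ zs y hy
    exact SetValued.coderivative_comp_eq hy fun xs hxs =>
      SetValued.exists_linear_minorant_of_isClosedSubspace hF hG hFc hGc hsub hy hxs
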